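/- **Setting.** Let $\mathcal X$ be a compact metric space, and let $P$ be a Borel probability distribution on $\mathcal X\times\{+1,-1\}$. Let $k:\mathcal X^2\to\mathbb R$ be a continuous kernel with reproducing kernel Hilbert space $\mathcal H$, such that $\sup_x\sqrt{k(x,x)}\le K$ for some constant $0<K<\infty$ and $k$ is universal, i.e. $\mathcal H$ is dense in $C(\mathcal X)$ for the supremum norm. **Loss.** Let $\ell:\mathbb R\to[0,\infty)$ be non-decreasing and convex, with $\lim_{z\to\infty}\partial\ell(z)=\infty$: for every $M>0$ there is $z_0$ such that $g\ge M$ for all $z\ge z_0$ and all $g$ in the subdifferential $\partial\ell(z)$. Suppose that $\ell$ is differentiable with $\ell'(z)>0$ at every $z\ge-\ell(0)/2$. For $0\le\theta\le1$ and $\rho\in\mathbb R$ put $$\psi(\theta,\rho)=\ell(\rho)-\inf_{z\in\mathbb R}\Big\{\tfrac{1+\theta}{2}\ell(\rho-z)+\tfrac{1-\theta}{2}\ell(\rho+z)\Big\}.$$ Suppose that there are $\varepsilon\in(0,1]$ and a function $\widetilde\psi$, continuous and strictly increasing on $[0,\varepsilon]$, with $\widetilde\psi(0)=0$, $\widetilde\psi(\theta)>0$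 for $0<\theta\le\varepsilon$, and $\widetilde\psi(\theta)\le\inf_{\rho\ge-\ell(0)/2}\psi(\theta,\rho)$ for $0\le\theta\le\varepsilon$. **Risks.** For measurable $f:\mathcal X\to\mathbb R$ and $\rho\in\mathbb R$ let $$\mathcal R(f,\rho)=-2\rho+\mathbb E[\ell(\rho-yf(x))]\in(-\infty,\infty],\qquad \mathcal E(f)=P(yf(x)\le0),$$ where $(x,y)\sim P$, and let $\mathcal R^*=\inf\{\mathcal R(f,\rho): f \text{ measurable},\ \rho\in\mathbb R\}\in[-\infty,\infty)$ and $\mathcal E^*=\inf\{\mathcal E(f): f\text{ measurable}\}$ (the Bayes risk). **Estimators.** Let $T_1=\{(x^{(1)}_i,y^{(1)}_i)\}_{i=1}^{m_1}$ and $T_2=\{(x^{(2)}_i,y^{(2)}_i)\}_{i=1}^{m_2}$ be independent i.i.d. samples from $P$, and let $\lambda_{m_1}>0$ for every $m_1$. Let $(\widehat f,\widehat b,\widehat\rho)\in\mathcal H\times\mathbb R\times\mathbb R$ be a measurable function of $T_1$ which is a solution of $$\min_{f\in\mathcal H,\;b,\rho\in\mathbb R}\ -2\rho+\frac1{m_1}\sum_{i=1}^{m_1}\ell\big(\rho-y^{(1)}_i(f(x^{(1)}_i)+b)\big)\quad\text{subject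 to } \|f\|_{\mathcal H}^2\le\lambda_{m_1}^2$$ whenever this problem has a solution (and is arbitrary otherwise). Let $\widetilde b$ be a measurable function of $(T_1,T_2)$ which minimizes the empirical 0-1 error on $T_2$, $$\widehat{\mathcal E}_{T_2}(\widehat f+b)=\frac1{m_2}\,\#\big\{i: y^{(2)}_i(\widehat f(x^{(2)}_i)+b)\le0\big\},\qquad\text{over } b\in\mathbb R.$$ **Theorem.** If $\mathcal R(\widehat f+\widehat b,\widehat\rho)\to\mathcal R^*$ in probability as $m_1\to\infty$ (if $\mathcal R^*=-\infty$, this means $\Pr(\mathcal R(\widehat f+\widehat b,\widehat\rho)>-M)\to0$ for every $M>0$), then $\mathcal E(\widehat f+\widetilde b)\to\mathcal E^*$ in probability as $m_1,m_2\to\infty$. -/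

import Mathlib

open MeasureTheory Filter Topology
open scoped ENNReal

noncomputable section

/-- The binary labels `{+1, -1}`, as real numbers. -/
abbrev Label : Type := {y : ℝ // y = 1 ∨ y = -1}

/-- Convergence in probability to a constant `c`, for random variables `Y i` that may live on
different probability spaces `(Ω i, μ i)`: for every neighbourhood `U` of `c`, the probability of
`Y i ∉ U` tends to `0`. For real-valued `Y i` this is the usual definition with `|Y i - c| ≥ ε`;
for extended real values it also makes sense at an infinite `c`. -/
def TendstoInProbability {ι : Type*} {Ω : ι → Type*} [∀ i, MeasurableSpace (Ω i)]
    {E : Type*} [TopologicalSpace E] (μ : ∀ i, Measure (Ω i)) (Y : ∀ i, Ω i → E)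
    (l : Filter ι) (c : E) : Prop :=
  ∀ U ∈ 𝓝 c, Tendsto (fun i => μ i {ω | Y i ω ∉ U}) l (𝓝 0)

section Risk

variable {X : Type*}

/-- The expected 0-1 loss `P (y f(x) ≤ 0)`. -/
def zeroOneRisk [MeasurableSpace X] (P : Measure (X × Label)) (f : X → ℝ) : ℝ :=
  P.real {z | (z.2 : ℝ) * f z.1 ≤ 0}

/-- The Bayes risk: the infimum of the expected 0-1 loss over all measurable functions. -/
def bayesRisk [MeasurableSpace X] (P : Measure (X × Label)) : ℝ :=
  ⨅ f : {f : X → ℝ // Measurable f}, zeroOneRisk P f.1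

open Classical in
/-- The empirical 0-1 loss on a sample `T` of size `m`. -/
def empZeroOneRisk {m : ℕ} (T : Fin m → X × Label) (f : X → ℝ) : ℝ :=
  (1 / (m : ℝ)) * ∑ i, if ((T i).2 : ℝ) * f (T i).1 ≤ 0 then 1 else 0

/-- The expected loss `-2ρ + E[ℓ(ρ - y f(x))]`. The loss is non-negative, so that the expectation
always exists in `[0, ∞]`, and the value lies in `(-∞, ∞]`. -/
def surrogateRisk [MeasurableSpace X] (ℓ : ℝ → ℝ) (P : Measure (X × Label)) (f : X → ℝ) (ρ : ℝ) :
    EReal :=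
  ((-2 * ρ : ℝ) : EReal) +
    ((∫⁻ z, ENNReal.ofReal (ℓ (ρ - (z.2 : ℝ) * f z.1)) ∂P : ℝ≥0∞) : EReal)

/-- The infimum of the expected loss over all measurable `f` and all real `ρ`
(possibly `-∞`). -/
def optSurrogateRisk [MeasurableSpace X] (ℓ : ℝ → ℝ) (P : Measure (X × Label)) : EReal :=
  ⨅ f : {f : X → ℝ // Measurable f}, ⨅ ρ : ℝ, surrogateRisk ℓ P f.1 ρ

/-- The empirical loss `-2ρ + (1/m) ∑ ℓ(ρ - yᵢ f(xᵢ))`. -/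
def empSurrogateRisk {m : ℕ} (ℓ : ℝ → ℝ) (T : Fin m → X × Label) (f : X → ℝ) (ρ : ℝ) : ℝ :=
  -2 * ρ + (1 / (m : ℝ)) * ∑ i, ℓ (ρ - ((T i).2 : ℝ) * f (T i).1)

end Risk

section Kernel

variable {X : Type*} (H : Type*) [NormedAddCommGroup H] [InnerProductSpace ℝ H] [RKHS ℝ H X ℝ]

/-- `H` is the reproducing kernel Hilbert space of the kernel `k`. -/
def HasKernel [CompleteSpace H] (k : X → X → ℝ) : Prop :=
  ∀ x y, RKHS.kernel H x y 1 = k x y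

/-- The kernel `k` with reproducing kernel Hilbert space `H` is continuous, bounded on the
diagonal, and universal: `H` is dense in `C(X, ℝ)` for the supremum norm. -/
structure UniversalKernel [MetricSpace X] [CompactSpace X] (k : X → X → ℝ) : Prop where
  continuous_kernel : Continuous fun p : X × X => k p.1 p.2
  bounded : ∃ K : ℝ, 0 < K ∧ ∀ x, √(k x x) ≤ K
  dense : Dense {g : C(X, ℝ) | ∃ f : H, ∀ x, f x = g x}

variable {H}

/-- `(f, b, ρ)` minimizes the empirical loss of `(f + b, ρ)` on the sample `T` over
`f ∈ H`, `b ∈ ℝ`, `ρ ∈ ℝ` subject to `‖f‖² ≤ lam²`. -/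
def IsRegularizedMinimizer {m : ℕ} (ℓ : ℝ → ℝ) (lam : ℝ) (T : Fin m → X × Label)
    (f : H) (b ρ : ℝ) : Prop :=
  ‖f‖ ^ 2 ≤ lam ^ 2 ∧
    ∀ (g : H) (c σ : ℝ), ‖g‖ ^ 2 ≤ lam ^ 2 →
      empSurrogateRisk ℓ T (fun x => f x + b) ρ ≤ empSurrogateRisk ℓ T (fun x => g x + c) σ

end Kernel

section Loss

/-- The subdifferential of `ℓ : ℝ → ℝ` at `z`. -/
def subdiff (ℓ : ℝ → ℝ) (z : ℝ) : Set ℝ :=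
  {g | ∀ w, ℓ z + g * (w - z) ≤ ℓ w}

/-- The basic assumptions on the loss function. -/
structure BasicLoss (ℓ : ℝ → ℝ) : Prop where
  monotone : Monotone ℓ
  convex : ConvexOn ℝ Set.univ ℓ
  nonneg : ∀ z, 0 ≤ ℓ z
  subdiff_tendsto : ∀ M : ℝ, 0 < M → ∃ z₀ : ℝ, ∀ z, z₀ ≤ z → ∀ g ∈ subdiff ℓ z, M ≤ g

/-- The function `ψ(θ, ρ)`, of interest for `0 ≤ θ ≤ 1`. -/
def psiTransform (ℓ : ℝ → ℝ) (θ ρ : ℝ) : ℝ :=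
  ℓ ρ - ⨅ z : ℝ, ((1 + θ) / 2 * ℓ (ρ - z) + (1 - θ) / 2 * ℓ (ρ + z))

/-- The modified classification-calibration assumption. The bound `ε ≤ 1` reflects that `ψ(θ, ρ)`
is defined for `0 ≤ θ ≤ 1` only. -/
structure ModifiedClassificationCalibrated (ℓ : ℝ → ℝ) : Prop where
  differentiable : ∀ z, -ℓ 0 / 2 ≤ z → DifferentiableAt ℝ ℓ z
  deriv_pos : ∀ z, -ℓ 0 / 2 ≤ z → 0 < deriv ℓ z
  exists_lower_bound : ∃ (ψt : ℝ → ℝ) (ε : ℝ), 0 < ε ∧ ε ≤ 1 ∧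
    ψt 0 = 0 ∧ (∀ θ, 0 < θ → θ ≤ ε → 0 < ψt θ) ∧
    ContinuousOn ψt (Set.Icc 0 ε) ∧ StrictMonoOn ψt (Set.Icc 0 ε) ∧
    ∀ θ ∈ Set.Icc 0 ε, ψt θ ≤ ⨅ ρ : Set.Ici (-ℓ 0 / 2), psiTransform ℓ θ ρ.1

end Loss

end

/-! Write `θ` for the conditional mean of the label. Calibration: if `f` has the wrong sign at a
point with `|θ| ≥ δ`, its conditional loss is at least `ℓ ρ` by Jensen, while some prediction of the
right sign loses at most `ℓ ρ - c / 2`, where `c ≤ psiTransform ℓ δ ρ`. Correcting `f` at these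
points shows that the excess surrogate risk is at least `c / 2` times their probability
(`optSurrogateRisk_add_le`). The bound `c` is uniform over `ρ ≥ -ℓ 0 / 2`; for smaller `ρ` the
surrogate risk exceeds that of the zero function with `ρ = 0`, to which the bound applies. Wrong
signs where `|θ| < δ` cost at most `δ`, so near-optimal surrogate risk yields near-Bayes 0-1 risk
after a small shift. If the optimal surrogate risk is `-∞`, superlinear growth of `ℓ` forces the 0-1
risk itself to be small.

Choice of the bias: given the first sample, `f` is fixed and the error sets of its shifts are built
from two monotone families of sets. Such families have finite bracketings whose size does not depend
on `f`, so Chebyshev on finitely many sets bounds the failure probability of empirical minimization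
uniformly in `f` (`exists_tendsto_measure_zeroOneRisk_erm`). Fubini combines the two samples. -/

/-! ### The conditional risk of the surrogate loss -/

/-- The expected loss of the prediction `z` under a label of conditional mean `θ`. -/
noncomputable def condLoss (ℓ : ℝ → ℝ) (θ ρ z : ℝ) : ℝ :=
  (1 + θ) / 2 * ℓ (ρ - z) + (1 - θ) / 2 * ℓ (ρ + z)

theorem condLoss_neg (ℓ : ℝ → ℝ) (θ ρ z : ℝ) : condLoss ℓ (-θ) ρ (-z) = condLoss ℓ θ ρ z := by
  unfold condLoss
  rw [sub_neg_eq_add, sub_neg_eq_add, ← sub_eq_add_neg, ← sub_eq_add_neg]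
  ring

namespace BasicLoss

variable {ℓ : ℝ → ℝ}

theorem condLoss_nonneg (hℓ : BasicLoss ℓ) {θ : ℝ} (hθ : |θ| ≤ 1) (ρ z : ℝ) :
    0 ≤ condLoss ℓ θ ρ z := by
  have h := abs_le.1 hθ
  exact add_nonneg (mul_nonneg (by linarith) (hℓ.nonneg _))
    (mul_nonneg (by linarith) (hℓ.nonneg _))

/-- Jensen: the two arguments average to `ρ - θ * z ≥ ρ`, and `ℓ` is monotone. -/
theorem le_condLoss_of_mul_nonpos (hℓ : BasicLoss ℓ) {θ z : ℝ} (hθ : |θ| ≤ 1)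
    (hz : θ * z ≤ 0) (ρ : ℝ) : ℓ ρ ≤ condLoss ℓ θ ρ z := by
  have h := abs_le.1 hθ
  have hc := hℓ.convex.2 (Set.mem_univ (ρ - z)) (Set.mem_univ (ρ + z))
    (show 0 ≤ (1 + θ) / 2 by linarith) (show 0 ≤ (1 - θ) / 2 by linarith) (by ring)
  simp only [smul_eq_mul] at hc
  exact (hℓ.monotone (by nlinarith)).trans hc

/-- Raising `θ` moves weight from `ℓ (ρ + z)` to the smaller `ℓ (ρ - z)`. -/
theorem condLoss_anti (hℓ : BasicLoss ℓ) {θ θ' : ℝ} (h : θ ≤ θ') (ρ : ℝ) {z : ℝ} (hz : 0 ≤ z) :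
    condLoss ℓ θ' ρ z ≤ condLoss ℓ θ ρ z := by
  have h1 : ℓ (ρ - z) ≤ ℓ (ρ + z) := hℓ.monotone (by linarith)
  unfold condLoss
  nlinarith

/-- If `ψ(δ, ρ) ≥ c`, then a single prediction of the right sign improves on the trivial
prediction by `c / 2`, for all conditional means `θ` with `|θ| ≥ δ`. -/
theorem exists_condLoss_add_le (hℓ : BasicLoss ℓ) {δ c ρ : ℝ} (hδ : 0 < δ) (hδ1 : δ ≤ 1)
    (hc : 0 < c) (hψ : c ≤ psiTransform ℓ δ ρ) :
    ∃ z : ℝ, ∀ θ, δ ≤ |θ| → |θ| ≤ 1 →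
      condLoss ℓ θ ρ (if 0 < θ then z else -z) + c / 2 ≤ ℓ ρ := by
  -- The infimum need not be attained; giving up half of `c` yields an actual `z`.
  have hlt : (⨅ z : ℝ, condLoss ℓ δ ρ z) < ℓ ρ - c / 2 := by
    have : psiTransform ℓ δ ρ = ℓ ρ - ⨅ z : ℝ, condLoss ℓ δ ρ z := rfl
    linarith
  obtain ⟨z, hz⟩ := exists_lt_of_ciInf_lt hlt
  have hz0 : 0 ≤ z := by
    by_contra! hneg
    have := hℓ.le_condLoss_of_mul_nonpos (abs_le.2 ⟨by linarith, hδ1⟩)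
      (mul_nonpos_of_nonneg_of_nonpos hδ.le hneg.le) ρ
    linarith
  refine ⟨z, fun θ h1 h2 => ?_⟩
  split_ifs with h
  · rw [abs_of_pos h] at h1
    linarith [hℓ.condLoss_anti h1 ρ hz0]
  · rw [abs_of_nonpos (not_lt.1 h)] at h1
    have := hℓ.condLoss_anti h1 ρ hz0
    rw [← condLoss_neg, neg_neg] at this
    linarith

/-- The loss grows faster than every linear function. -/
theorem eventually_mul_le (hℓ : BasicLoss ℓ)
    (hd : ∀ z, -ℓ 0 / 2 ≤ z → DifferentiableAt ℝ ℓ z) (M : ℝ) :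
    ∀ᶠ ρ in atTop, M * ρ ≤ ℓ ρ := by
  -- The factor 2 absorbs the offset of the tangent at `a`: `2 * M' * (ρ - a) ≥ M' * ρ` once `ρ ≥ 2
  -- * a`.
  obtain ⟨z₀, hz₀⟩ := hℓ.subdiff_tendsto (2 * max M 1) (by positivity)
  set a := max z₀ (max 0 (-ℓ 0 / 2))
  have ha : DifferentiableAt ℝ ℓ a := hd a ((le_max_right _ _).trans (le_max_right _ _))
  have ha0 : 0 ≤ a := (le_max_left _ _).trans (le_max_right _ _)
  have hsub : deriv ℓ a ∈ subdiff ℓ a := by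
    intro w
    rcases lt_trichotomy a w with h | h | h
    · have := hℓ.convex.le_slope_of_hasDerivAt (Set.mem_univ a) (Set.mem_univ w) h ha.hasDerivAt
      rw [slope_def_field, le_div_iff₀ (by linarith)] at this
      linarith
    · simp [h]
    · have := hℓ.convex.slope_le_of_hasDerivAt (Set.mem_univ w) (Set.mem_univ a) h ha.hasDerivAt
      rw [slope_def_field, div_le_iff₀ (by linarith)] at this
      linarith
  have hM := hz₀ a (le_max_left _ _) _ hsub
  filter_upwards [eventually_ge_atTop (2 * a)] with ρ hρ
  have h1 := hsub ρ
  have h2 : 2 * max M 1 * (ρ - a) ≤ deriv ℓ a * (ρ - a) :=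
    mul_le_mul_of_nonneg_right hM (by linarith)
  have h3 : M * ρ ≤ max M 1 * ρ := mul_le_mul_of_nonneg_right (le_max_left _ _) (by linarith)
  have h4 : 0 ≤ max M 1 * (ρ - 2 * a) := mul_nonneg (by positivity) (by linarith)
  nlinarith [hℓ.nonneg a]

end BasicLoss

/-! ### Conditional mean of the label -/

/-- The label `+1`. -/
def Label.pos : Label := ⟨1, Or.inl rfl⟩

/-- The label `-1`. -/
def Label.neg : Label := ⟨-1, Or.inr rfl⟩

theorem Label.coe_pos : (Label.pos : ℝ) = 1 := rfl

theorem Label.coe_neg : (Label.neg : ℝ) = -1 := rfl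

theorem Label.eq_pos_or_neg (y : Label) : y = Label.pos ∨ y = Label.neg :=
  y.2.imp Subtype.ext Subtype.ext

theorem Label.pos_ne_neg : Label.pos ≠ Label.neg := fun h => by
  have := congrArg Subtype.val h
  norm_num [Label.pos, Label.neg] at this

theorem Label.measurableSet_range : MeasurableSet {y : ℝ | y = 1 ∨ y = -1} :=
  (measurableSet_singleton 1).union (measurableSet_singleton (-1))

/-- `θ` is the conditional mean of the label under `P`. -/
structure IsCondMean {X : Type*} [MeasurableSpace X] (P : Measure (X × Label)) (θ : X → ℝ) :
    Prop where
  measurable : Measurable θ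
  abs_le_one : ∀ x, |θ x| ≤ 1
  lintegral_eq : ∀ g : X × Label → ℝ≥0∞, Measurable g →
    ∫⁻ z, g z ∂P = ∫⁻ x, (ENNReal.ofReal ((1 + θ x) / 2) * g (x, Label.pos) +
      ENNReal.ofReal ((1 - θ x) / 2) * g (x, Label.neg)) ∂P.fst

/-- Disintegrate `P` over its first marginal: a law on two labels is determined by its mass `p` at
`+1`, and `θ = 2 * p - 1`. -/
theorem exists_isCondMean {X : Type*} [MeasurableSpace X] (P : Measure (X × Label))
    [IsProbabilityMeasure P] : ∃ θ, IsCondMean P θ := by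
  have : StandardBorelSpace Label := Label.measurableSet_range.standardBorel
  have : Nonempty Label := ⟨Label.pos⟩
  have hneg : ∀ x, (P.condKernel x).real {Label.neg} = 1 - (P.condKernel x).real {Label.pos} := by
    intro x
    rw [← probReal_compl_eq_one_sub (measurableSet_singleton _)]
    congr 1
    ext y
    rcases y.eq_pos_or_neg with h | h <;> simp [h, Label.pos_ne_neg, Label.pos_ne_neg.symm]
  refine ⟨fun x => 2 * (P.condKernel x).real {Label.pos} - 1, ?_, fun x => ?_, fun g hg => ?_⟩
  · exact (((P.condKernel.measurable_coe (measurableSet_singleton _)).ennreal_toReal).const_mul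
      2).sub_const 1
  · rw [abs_le]
    constructor <;> linarith [measureReal_nonneg (μ := P.condKernel x) (s := {Label.pos}),
      measureReal_le_one (μ := P.condKernel x) (s := {Label.pos})]
  · rw [← Measure.lintegral_condKernel hg]
    refine lintegral_congr fun x => ?_
    have hset : (Set.univ : Set Label) = {Label.pos} ∪ {Label.neg} := by
      ext y
      simpa [or_comm] using y.eq_pos_or_neg
    rw [← setLIntegral_univ, hset, lintegral_union (measurableSet_singleton _)
      (by simpa using Label.pos_ne_neg), lintegral_singleton, lintegral_singleton,
      mul_comm, mul_comm (g (x, Label.neg))]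
    congr 2
    · rw [← ofReal_measureReal]; congr 1; ring
    · rw [← ofReal_measureReal, hneg]; congr 1; ring

/-! ### Excess risk bounds -/

/-- The points where the sign of `f` is wrong and the conditional mean `θ` of the label is at
least `δ` in absolute value. -/
def wrongSignSet {X : Type*} (θ f : X → ℝ) (δ : ℝ) : Set X :=
  {x | f x * θ x ≤ 0 ∧ δ ≤ |θ x|}

namespace IsCondMean

variable {X : Type*} [MeasurableSpace X] {P : Measure (X × Label)} {θ f : X → ℝ} {ℓ : ℝ → ℝ}

theorem measurableSet_wrongSignSet (hθ : IsCondMean P θ) (hf : Measurable f) (δ : ℝ) :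
    MeasurableSet (wrongSignSet θ f δ) := by
  exact (measurableSet_le (hf.mul hθ.measurable) measurable_const).inter
    (measurableSet_le measurable_const hθ.measurable.abs)

theorem lintegral_loss (hθ : IsCondMean P θ) (hℓ : BasicLoss ℓ) (hf : Measurable f) (ρ : ℝ) :
    ∫⁻ z, ENNReal.ofReal (ℓ (ρ - (z.2 : ℝ) * f z.1)) ∂P =
      ∫⁻ x, ENNReal.ofReal (condLoss ℓ (θ x) ρ (f x)) ∂P.fst := by
  have hm := hℓ.monotone.measurable
  rw [hθ.lintegral_eq _ (by fun_prop)]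
  refine lintegral_congr fun x => ?_
  have h := abs_le.1 (hθ.abs_le_one x)
  have h1 : 0 ≤ (1 + θ x) / 2 := by linarith
  have h2 : 0 ≤ (1 - θ x) / 2 := by linarith
  simp only [Label.coe_pos, Label.coe_neg, one_mul, neg_mul, sub_neg_eq_add]
  rw [← ENNReal.ofReal_mul h1, ← ENNReal.ofReal_mul h2,
    ← ENNReal.ofReal_add (mul_nonneg h1 (hℓ.nonneg _)) (mul_nonneg h2 (hℓ.nonneg _))]
  rfl

/-- Calibration at a fixed `ρ`: if `ψ(δ, ρ) ≥ c`, then the excess surrogate risk controls the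
probability of the wrong sign at points with `|θ| ≥ δ`. -/
theorem optSurrogateRisk_add_le_of_le_psiTransform (hθ : IsCondMean P θ) (hℓ : BasicLoss ℓ)
    (hf : Measurable f) {δ c ρ : ℝ} (hδ : 0 < δ) (hδ1 : δ ≤ 1) (hc : 0 < c)
    (hψ : c ≤ psiTransform ℓ δ ρ) :
    optSurrogateRisk ℓ P +
        ((ENNReal.ofReal (c / 2) * P.fst (wrongSignSet θ f δ) : ℝ≥0∞) : EReal) ≤
      surrogateRisk ℓ P f ρ := by
  classical
  obtain ⟨z, hz⟩ := hℓ.exists_condLoss_add_le hδ hδ1 hc hψ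
  set A := wrongSignSet θ f δ
  have hA : MeasurableSet A := hθ.measurableSet_wrongSignSet hf δ
  -- The competitor differs from `f` only on `A`, so the losses are compared pointwise and no
  -- infinite integrals are subtracted.
  set g : X → ℝ := A.piecewise (fun x => if 0 < θ x then z else -z) f
  have hg : Measurable g := Measurable.piecewise hA
    (Measurable.ite (measurableSet_lt measurable_const hθ.measurable)
      measurable_const measurable_const) hf
  have hopt : optSurrogateRisk ℓ P ≤ surrogateRisk ℓ P g ρ :=
    (iInf_le _ (⟨g, hg⟩ : {f : X → ℝ // Measurable f})).trans (iInf_le _ ρ)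
  have hint : ∫⁻ x, ENNReal.ofReal (condLoss ℓ (θ x) ρ (g x)) ∂P.fst +
      ENNReal.ofReal (c / 2) * P.fst A ≤
      ∫⁻ x, ENNReal.ofReal (condLoss ℓ (θ x) ρ (f x)) ∂P.fst := by
    rw [← setLIntegral_const, ← lintegral_indicator hA,
      ← lintegral_add_right _ (measurable_const.indicator hA)]
    refine lintegral_mono fun x => ?_
    by_cases hx : x ∈ A
    · simp only [g, Set.piecewise_eq_of_mem _ _ _ hx, Set.indicator_of_mem hx]
      rw [← ENNReal.ofReal_add (hℓ.condLoss_nonneg (hθ.abs_le_one x) _ _) (by positivity)]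
      refine ENNReal.ofReal_le_ofReal ((hz _ hx.2 (hθ.abs_le_one x)).trans ?_)
      exact hℓ.le_condLoss_of_mul_nonpos (hθ.abs_le_one x) (by rw [mul_comm]; exact hx.1) ρ
    · simp only [g, Set.piecewise_eq_of_notMem _ _ _ hx, Set.indicator_of_notMem hx, add_zero,
        le_refl]
  refine (add_le_add_left hopt _).trans ?_
  unfold surrogateRisk
  rw [hθ.lintegral_loss hℓ hf, hθ.lintegral_loss hℓ hg, add_assoc, ← EReal.coe_ennreal_add]
  gcongr
  exact_mod_cast hint

/-- Calibration: the excess surrogate risk controls the probability of the wrong sign at points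
with `|θ| ≥ δ`, uniformly in `ρ`. -/
theorem optSurrogateRisk_add_le (hθ : IsCondMean P θ) [IsProbabilityMeasure P]
    (hℓ : BasicLoss ℓ) (hf : Measurable f) {δ c : ℝ} (hδ : 0 < δ) (hδ1 : δ ≤ 1) (hc : 0 < c)
    (hψ : ∀ ρ, -ℓ 0 / 2 ≤ ρ → c ≤ psiTransform ℓ δ ρ) (ρ : ℝ) :
    optSurrogateRisk ℓ P +
        ((ENNReal.ofReal (c / 2) * P.fst (wrongSignSet θ f δ) : ℝ≥0∞) : EReal) ≤
      surrogateRisk ℓ P f ρ := by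
  rcases le_or_gt (-ℓ 0 / 2) ρ with hρ | hρ
  · exact hθ.optSurrogateRisk_add_le_of_le_psiTransform hℓ hf hδ hδ1 hc (hψ ρ hρ)
  -- Here `-2 * ρ > ℓ 0`, which is the risk of the zero function at `ρ = 0`. Zero counts as a wrong
  -- sign everywhere, so its wrong-sign set contains that of `f`.
  · have h0 := hθ.optSurrogateRisk_add_le_of_le_psiTransform hℓ (measurable_const (a := (0 : ℝ)))
      hδ hδ1 hc (hψ 0 (by linarith [hℓ.nonneg 0]))
    have hsub : wrongSignSet θ f δ ⊆ wrongSignSet θ (fun _ => (0 : ℝ)) δ := fun x hx =>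
      ⟨by simp, hx.2⟩
    calc _ ≤ optSurrogateRisk ℓ P + ((ENNReal.ofReal (c / 2) *
          P.fst (wrongSignSet θ (fun _ => (0 : ℝ)) δ) : ℝ≥0∞) : EReal) := by
          refine add_le_add_right (EReal.coe_ennreal_le_coe_ennreal_iff.2 ?_) _
          gcongr
      _ ≤ surrogateRisk ℓ P (fun _ => 0) 0 := h0
      _ = ((ℓ 0 : ℝ) : EReal) := by
          simp [surrogateRisk, EReal.coe_ennreal_ofReal, hℓ.nonneg 0]
      _ ≤ ((-2 * ρ : ℝ) : EReal) := EReal.coe_le_coe_iff.2 (by linarith)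
      _ ≤ surrogateRisk ℓ P f ρ := by
          unfold surrogateRisk
          exact le_add_of_nonneg_right (EReal.coe_ennreal_nonneg _)

theorem measure_eq (hθ : IsCondMean P θ) {S : Set (X × Label)} (hS : MeasurableSet S) :
    P S = ∫⁻ x, (ENNReal.ofReal ((1 + θ x) / 2) * S.indicator 1 (x, Label.pos) +
      ENNReal.ofReal ((1 - θ x) / 2) * S.indicator 1 (x, Label.neg)) ∂P.fst := by
  rw [← lintegral_indicator_one hS, hθ.lintegral_eq _ (measurable_one.indicator hS)]

theorem measurableSet_error (hf : Measurable f) :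
    MeasurableSet {z : X × Label | (z.2 : ℝ) * f z.1 ≤ 0} :=
  measurableSet_le (by fun_prop) measurable_const

/-- The Bayes risk is at least the integral of the pointwise minimal error. -/
theorem lintegral_le_bayesRisk (hθ : IsCondMean P θ) [IsProbabilityMeasure P] :
    ∫⁻ x, ENNReal.ofReal ((1 - |θ x|) / 2) ∂P.fst ≤ ENNReal.ofReal (bayesRisk P) := by
  have hle : ∀ f : X → ℝ, Measurable f → ∫⁻ x, ENNReal.ofReal ((1 - |θ x|) / 2) ∂P.fst ≤
      P {z : X × Label | (z.2 : ℝ) * f z.1 ≤ 0} := by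
    intro f hf
    rw [hθ.measure_eq (measurableSet_error hf)]
    refine lintegral_mono fun x => ?_
    rcases le_or_gt (f x) 0 with h | h
    · rw [Set.indicator_of_mem (s := {z : X × Label | (z.2 : ℝ) * f z.1 ≤ 0}) (a := (x, Label.pos))
        (show (1 : ℝ) * f x ≤ 0 by linarith), Pi.one_apply, mul_one]
      refine le_add_right (ENNReal.ofReal_le_ofReal ?_)
      linarith [neg_abs_le (θ x)]
    · rw [Set.indicator_of_mem (s := {z : X × Label | (z.2 : ℝ) * f z.1 ≤ 0}) (a := (x, Label.neg))
        (show (-1 : ℝ) * f x ≤ 0 by linarith), Pi.one_apply, mul_one]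
      refine le_add_left (ENNReal.ofReal_le_ofReal ?_)
      linarith [le_abs_self (θ x)]
  have hne : ∫⁻ x, ENNReal.ofReal ((1 - |θ x|) / 2) ∂P.fst ≠ ∞ :=
    ne_top_of_le_ne_top (measure_ne_top P _) (hle 0 measurable_zero)
  have : Nonempty {f : X → ℝ // Measurable f} := ⟨⟨0, measurable_zero⟩⟩
  refine (ENNReal.le_ofReal_iff_toReal_le hne
    (Real.iInf_nonneg fun _ => measureReal_nonneg)).2 ?_
  refine le_ciInf fun f => ?_
  exact ENNReal.toReal_mono (measure_ne_top P _) (hle f.1 f.2)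

/-- A small shift of `f` has 0-1 risk not much larger than the Bayes risk plus the probability of
the wrong sign at points with `|θ| ≥ δ`. -/
theorem exists_zeroOneRisk_add_const_lt (hθ : IsCondMean P θ) [IsProbabilityMeasure P]
    (hf : Measurable f) {δ τ : ℝ} (hδ : 0 ≤ δ) (hτ : 0 < τ) :
    ∃ b : ℝ, zeroOneRisk P (fun x => f x + b) <
      bayesRisk P + δ + P.fst.real (wrongSignSet θ f δ) + τ := by
  -- A zero of `f` is an error for both labels, so `f` itself may be far from Bayes. A shift by `s >
  -- 0` breaks the ties: its error set lies in `S s`, and `S s` decreases to `S 0`, where ties go to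
  -- `+1`.
  set S : ℝ → Set (X × Label) := fun s =>
    {z | (z.2 : ℝ) = 1 ∧ f z.1 < 0 ∨ (z.2 : ℝ) = -1 ∧ -s ≤ f z.1} with hSdef
  have hy : Measurable fun z : X × Label => (z.2 : ℝ) := by fun_prop
  have hfx : Measurable fun z : X × Label => f z.1 := by fun_prop
  have hSm : ∀ s, MeasurableSet (S s) := fun s =>
    ((measurableSet_eq_fun hy measurable_const).inter
      (measurableSet_lt hfx measurable_const)).union
    ((measurableSet_eq_fun hy measurable_const).inter
      (measurableSet_le measurable_const hfx))
  have hB0 : 0 ≤ bayesRisk P := Real.iInf_nonneg fun _ => measureReal_nonneg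
  have hS0 : P.real (S 0) ≤ bayesRisk P + δ + P.fst.real (wrongSignSet θ f δ) := by
    have hA := hθ.measurableSet_wrongSignSet hf δ
    have key : P (S 0) ≤ ENNReal.ofReal (bayesRisk P) + ENNReal.ofReal δ +
        P.fst (wrongSignSet θ f δ) := by
      calc P (S 0) ≤ ∫⁻ x, (ENNReal.ofReal ((1 - |θ x|) / 2) + ENNReal.ofReal δ +
            (wrongSignSet θ f δ).indicator 1 x) ∂P.fst := by
            rw [hθ.measure_eq (hSm 0)]
            refine lintegral_mono fun x => ?_
            have h1 := abs_le.1 (hθ.abs_le_one x)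
            have hp : (x, Label.pos) ∈ S 0 ↔ f x < 0 := by
              simp only [hSdef, Set.mem_ofPred_eq, Label.coe_pos]; norm_num
            have hn : (x, Label.neg) ∈ S 0 ↔ 0 ≤ f x := by
              simp only [hSdef, Set.mem_ofPred_eq, Label.coe_neg]; norm_num
            have hw : (wrongSignSet θ f δ).indicator (1 : X → ℝ≥0∞) x =
                ENNReal.ofReal ((wrongSignSet θ f δ).indicator 1 x) := by
              by_cases h : x ∈ wrongSignSet θ f δ <;> simp [h]
            have hw0 : 0 ≤ (wrongSignSet θ f δ).indicator (1 : X → ℝ) x :=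
              Set.indicator_nonneg (fun _ _ => zero_le_one) _
            -- A wrong sign raises the pointwise error from `(1 - |θ x|) / 2` to `(1 + |θ x|) / 2`,
            -- an excess of `|θ x|`.
            have hgood : f x * θ x ≤ 0 →
                |θ x| ≤ δ + (wrongSignSet θ f δ).indicator (1 : X → ℝ) x := by
              intro h
              rcases le_or_gt δ |θ x| with h2 | h2
              · rw [Set.indicator_of_mem (show x ∈ wrongSignSet θ f δ from ⟨h, h2⟩)]
                simp only [Pi.one_apply]
                linarith [hθ.abs_le_one x]
              · linarith
            rw [hw, ← ENNReal.ofReal_add (by linarith [hθ.abs_le_one x]) hδ,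
              ← ENNReal.ofReal_add (by linarith [hθ.abs_le_one x]) hw0]
            rcases lt_or_ge (f x) 0 with h | h
            · rw [Set.indicator_of_mem (hp.2 h),
                Set.indicator_of_notMem (fun h' => absurd (hn.1 h') (not_le.2 h))]
              simp only [Pi.one_apply, mul_one, mul_zero, add_zero]
              refine ENNReal.ofReal_le_ofReal ?_
              rcases le_or_gt (θ x) 0 with h2 | h2
              · rw [abs_of_nonpos h2]; linarith
              · have := hgood (mul_nonpos_of_nonpos_of_nonneg h.le h2.le)
                rw [abs_of_pos h2] at this ⊢; linarith
            · rw [Set.indicator_of_mem (hn.2 h),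
                Set.indicator_of_notMem (fun h' => absurd (hp.1 h') (not_lt.2 h))]
              simp only [Pi.one_apply, mul_one, mul_zero, zero_add]
              refine ENNReal.ofReal_le_ofReal ?_
              rcases le_or_gt 0 (θ x) with h2 | h2
              · rw [abs_of_nonneg h2]; linarith
              · have := hgood (mul_nonpos_of_nonneg_of_nonpos h h2.le)
                rw [abs_of_neg h2] at this ⊢; linarith
        _ = ∫⁻ x, ENNReal.ofReal ((1 - |θ x|) / 2) ∂P.fst + ENNReal.ofReal δ +
            P.fst (wrongSignSet θ f δ) := by
            rw [lintegral_add_right _ (measurable_one.indicator hA), lintegral_indicator_one hA,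
              lintegral_add_right _ measurable_const, lintegral_const, measure_univ, mul_one]
        _ ≤ _ := by gcongr; exact hθ.lintegral_le_bayesRisk
    have := ENNReal.toReal_mono (by finiteness) key
    rwa [ENNReal.toReal_add (by finiteness) (by finiteness),
      ENNReal.toReal_add (by finiteness) (by finiteness), ENNReal.toReal_ofReal hB0,
      ENNReal.toReal_ofReal hδ] at this
  have hlim : Tendsto (fun n : ℕ => P.real (S (1 / ((n : ℝ) + 1)))) atTop (𝓝 (P.real (S 0))) := by
    have hinter : ⋂ n : ℕ, S (1 / ((n : ℝ) + 1)) = S 0 := by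
      ext z
      simp only [hSdef, Set.mem_iInter, Set.mem_ofPred_eq]
      constructor
      · intro h
        rcases (h 0) with h0 | h0
        · exact Or.inl h0
        · refine Or.inr ⟨h0.1, ?_⟩
          have : Tendsto (fun n : ℕ => -(1 / ((n : ℝ) + 1))) atTop (𝓝 (-0)) :=
            tendsto_one_div_add_atTop_nhds_zero_nat.neg
          refine le_of_tendsto this (Eventually.of_forall fun n => ?_)
          rcases h n with hn | hn
          · rw [h0.1] at hn; norm_num at hn
          · exact hn.2
      · rintro (h | h) n
        · exact Or.inl h
        · exact Or.inr ⟨h.1, le_trans (by simp; positivity) h.2⟩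
    have hanti : Antitone fun n : ℕ => S (1 / ((n : ℝ) + 1)) := by
      rintro m n hmn z (h | h)
      · exact Or.inl h
      · exact Or.inr ⟨h.1, le_trans (neg_le_neg (Nat.one_div_le_one_div hmn)) h.2⟩
    have := tendsto_measure_iInter_atTop (μ := P)
      (fun n : ℕ => (hSm (1 / ((n : ℝ) + 1))).nullMeasurableSet) hanti ⟨0, measure_ne_top P _⟩
    rw [hinter] at this
    exact (ENNReal.tendsto_toReal (measure_ne_top P _)).comp this
  obtain ⟨n, hn⟩ := (hlim.eventually_lt_const
    (show P.real (S 0) < P.real (S 0) + τ by linarith)).exists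
  refine ⟨1 / ((n : ℝ) + 1), lt_of_le_of_lt (measureReal_mono ?_) (hn.trans_le (by linarith))⟩
  intro z hz
  have hpos : 0 < 1 / ((n : ℝ) + 1) := Nat.one_div_pos_of_nat
  simp only [Set.mem_ofPred_eq] at hz
  rcases z.2.2 with h | h <;> rw [h] at hz
  · exact Or.inl ⟨h, by linarith⟩
  · exact Or.inr ⟨h, by linarith⟩

end IsCondMean

theorem bayesRisk_le_zeroOneRisk {X : Type*} [MeasurableSpace X] (P : Measure (X × Label))
    {f : X → ℝ} (hf : Measurable f) : bayesRisk P ≤ zeroOneRisk P f :=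
  ciInf_le ⟨0, by rintro _ ⟨g, rfl⟩; exact measureReal_nonneg⟩
    (⟨f, hf⟩ : {f : X → ℝ // Measurable f})

theorem bayesRisk_nonneg {X : Type*} [MeasurableSpace X] (P : Measure (X × Label)) :
    0 ≤ bayesRisk P :=
  Real.iInf_nonneg fun _ => measureReal_nonneg

/-- If the surrogate risk takes very negative values, then the 0-1 risk is small. -/
theorem exists_zeroOneRisk_lt_of_surrogateRisk_lt {X : Type*} [MeasurableSpace X]
    (P : Measure (X × Label)) [IsProbabilityMeasure P] {ℓ : ℝ → ℝ} (hℓ : BasicLoss ℓ)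
    (hd : ∀ z, -ℓ 0 / 2 ≤ z → DifferentiableAt ℝ ℓ z) {τ : ℝ} (hτ : 0 < τ) :
    ∃ M : ℝ, ∀ (f : X → ℝ) (ρ : ℝ), Measurable f → surrogateRisk ℓ P f ρ < (M : EReal) →
      zeroOneRisk P f < τ := by
  obtain ⟨ρ₀, hρ₀⟩ := eventually_atTop.1 (hℓ.eventually_mul_le hd (2 / τ))
  -- A risk below this value forces `ρ > max ρ₀ 1`, hence `ℓ ρ ≥ 2 * ρ / τ`; the risk being negative
  -- then gives `ℓ ρ * zeroOneRisk P f < 2 * ρ`.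
  refine ⟨-2 * max ρ₀ 1, fun f ρ hf h => ?_⟩
  set S := {z : X × Label | (z.2 : ℝ) * f z.1 ≤ 0}
  have hS : MeasurableSet S := IsCondMean.measurableSet_error hf
  have hint : ENNReal.ofReal (ℓ ρ) * P S ≤
      ∫⁻ z, ENNReal.ofReal (ℓ (ρ - (z.2 : ℝ) * f z.1)) ∂P := by
    rw [← setLIntegral_const]
    refine (setLIntegral_mono' hS fun z hz => ?_).trans (setLIntegral_le_lintegral _ _)
    exact ENNReal.ofReal_le_ofReal (hℓ.monotone (by
      have : (z.2 : ℝ) * f z.1 ≤ 0 := hz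
      linarith))
  have hreal : -2 * ρ + ℓ ρ * zeroOneRisk P f < -2 * max ρ₀ 1 := by
    rw [← EReal.coe_lt_coe_iff]
    refine lt_of_le_of_lt ?_ h
    unfold surrogateRisk
    rw [EReal.coe_add]
    refine add_le_add_right ?_ _
    refine le_trans (le_of_eq ?_) (EReal.coe_ennreal_le_coe_ennreal_iff.2 hint)
    rw [EReal.coe_ennreal_mul, EReal.coe_ennreal_ofReal, max_eq_left (hℓ.nonneg ρ),
      ← ofReal_measureReal, EReal.coe_ennreal_ofReal, max_eq_left measureReal_nonneg,
      ← EReal.coe_mul]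
    rfl
  have hz0 : 0 ≤ zeroOneRisk P f := measureReal_nonneg
  have h1 : 0 ≤ ℓ ρ * zeroOneRisk P f := mul_nonneg (hℓ.nonneg ρ) hz0
  have hρ1 : max ρ₀ 1 < ρ := by linarith
  have hρpos : 0 < ρ := lt_of_lt_of_le one_pos ((le_max_right _ _).trans hρ1.le)
  have h2 : 2 / τ * ρ ≤ ℓ ρ := hρ₀ ρ ((le_max_left _ _).trans hρ1.le)
  have h3 : 2 / τ * ρ * zeroOneRisk P f ≤ ℓ ρ * zeroOneRisk P f :=
    mul_le_mul_of_nonneg_right h2 hz0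
  have h4 : 2 / τ * ρ * zeroOneRisk P f < 2 * ρ := by
    linarith [le_max_right ρ₀ 1]
  by_contra! hcon
  have h5 : 2 / τ * ρ * τ ≤ 2 / τ * ρ * zeroOneRisk P f :=
    mul_le_mul_of_nonneg_left hcon (by positivity)
  have h6 : 2 / τ * ρ * τ = 2 * ρ := by field_simp
  linarith

/-- Near-optimality for the surrogate risk gives near-optimality for the 0-1 risk after a suitable
shift. -/
theorem eventually_exists_zeroOneRisk_add_const_lt {X : Type*} [MeasurableSpace X]
    (P : Measure (X × Label)) [IsProbabilityMeasure P] {ℓ : ℝ → ℝ} (hℓ : BasicLoss ℓ)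
    (hcal : ModifiedClassificationCalibrated ℓ) {τ : ℝ} (hτ : 0 < τ) :
    ∃ V ∈ 𝓝 (optSurrogateRisk ℓ P), ∀ (f : X → ℝ) (ρ : ℝ), Measurable f →
      surrogateRisk ℓ P f ρ ∈ V → ∃ b : ℝ, zeroOneRisk P (fun x => f x + b) < bayesRisk P + τ := by
  obtain ⟨θ, hθ⟩ := exists_isCondMean P
  obtain ⟨ψt, ε, hε, hε1, -, hpos, -, -, hbound⟩ := hcal.exists_lower_bound
  rcases eq_or_ne (optSurrogateRisk ℓ P) ⊥ with hbot | hbot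
  · obtain ⟨M, hM⟩ := exists_zeroOneRisk_lt_of_surrogateRisk_lt P hℓ hcal.differentiable hτ
    refine ⟨Set.Iio (M : EReal), Iio_mem_nhds (hbot ▸ EReal.bot_lt_coe M),
      fun f ρ hf hV => ⟨0, ?_⟩⟩
    simpa using (hM f ρ hf hV).trans_le (by linarith [bayesRisk_nonneg P])
  · have htop : optSurrogateRisk ℓ P ≠ ⊤ := by
      refine ne_top_of_le_ne_top ?_ ((iInf_le _
        (⟨0, measurable_zero⟩ : {f : X → ℝ // Measurable f})).trans (iInf_le _ 0))
      simp [surrogateRisk]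
    lift optSurrogateRisk ℓ P to ℝ using ⟨htop, hbot⟩ with r hr
    set δ := min ε (τ / 4)
    have hδ : 0 < δ := lt_min hε (by linarith)
    have hδε : δ ≤ ε := min_le_left _ _
    have hc := hpos δ hδ hδε
    have hψ : ∀ ρ, -ℓ 0 / 2 ≤ ρ → ψt δ ≤ psiTransform ℓ δ ρ := by
      intro ρ hρ
      refine (hbound δ ⟨hδ.le, hδε⟩).trans (ciInf_le (f := fun ρ : Set.Ici (-ℓ 0 / 2) =>
        psiTransform ℓ δ ρ.1) ⟨0, ?_⟩ ⟨ρ, hρ⟩)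
      rintro _ ⟨ρ', rfl⟩
      have hb : BddBelow (Set.range fun z => condLoss ℓ δ ρ'.1 z) := ⟨0, by
        rintro _ ⟨z, rfl⟩
        exact hℓ.condLoss_nonneg (abs_le.2 ⟨by linarith, by linarith⟩) _ _⟩
      have h0 := ciInf_le hb 0
      have h1 : condLoss ℓ δ ρ'.1 0 = ℓ ρ'.1 := by
        unfold condLoss; rw [sub_zero, add_zero]; ring
      have h2 : psiTransform ℓ δ ρ'.1 = ℓ ρ'.1 - ⨅ z : ℝ, condLoss ℓ δ ρ'.1 z := rfl
      simp only [h2]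
      linarith
    -- This excess makes the wrong-sign probability less than `τ / 4`; the ties and `δ` cost at most
    -- `τ / 4` each.
    refine ⟨Set.Iio ((r + ψt δ / 2 * (τ / 4) : ℝ) : EReal), Iio_mem_nhds ?_,
      fun f ρ hf hV => ?_⟩
    · rw [EReal.coe_lt_coe_iff]
      have : 0 < ψt δ / 2 * (τ / 4) := by positivity
      linarith
    have hle := (hθ.optSurrogateRisk_add_le hℓ hf hδ (hδε.trans hε1) hc hψ ρ).trans_lt hV
    rw [← hr, ← ofReal_measureReal, ← ENNReal.ofReal_mul (by positivity),
      EReal.coe_ennreal_ofReal, max_eq_left (by positivity), ← EReal.coe_add,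
      EReal.coe_lt_coe_iff, add_lt_add_iff_left, mul_lt_mul_iff_right₀ (by positivity)] at hle
    obtain ⟨b, hb⟩ := hθ.exists_zeroOneRisk_add_const_lt hf hδ.le (τ := τ / 4) (by linarith)
    exact ⟨b, hb.trans_le (by linarith [min_le_right ε (τ / 4)])⟩

/-! ### Uniform deviations for the 0-1 loss of shifted functions -/

/-- The empirical frequency of the set `C` in the sample `T`. -/
noncomputable def empFreq {Ω : Type*} {m : ℕ} (T : Fin m → Ω) (C : Set Ω) : ℝ :=
  (1 / (m : ℝ)) * ∑ i, C.indicator (1 : Ω → ℝ) (T i)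

theorem empFreq_mono {Ω : Type*} {m : ℕ} (T : Fin m → Ω) {C D : Set Ω} (h : C ⊆ D) :
    empFreq T C ≤ empFreq T D := by
  unfold empFreq
  gcongr with i
  exact zero_le_one

theorem empFreq_union {Ω : Type*} {m : ℕ} (T : Fin m → Ω) {C D : Set Ω} (h : Disjoint C D) :
    empFreq T (C ∪ D) = empFreq T C + empFreq T D := by
  simp only [empFreq, Set.indicator_union_of_disjoint h, Finset.sum_add_distrib, mul_add]

/-- Chebyshev's inequality for empirical frequencies. -/
theorem measure_le_abs_empFreq_sub {Ω : Type*} [MeasurableSpace Ω] (P : Measure Ω)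
    [IsProbabilityMeasure P] {m : ℕ} (hm : 0 < m) {C : Set Ω} (hC : MeasurableSet C) {δ : ℝ}
    (hδ : 0 < δ) :
    (Measure.pi fun _ : Fin m => P) {T | δ ≤ |empFreq T C - P.real C|} ≤
      ENNReal.ofReal (1 / (m * δ ^ 2)) := by
  have hm' : (0 : ℝ) < m := by exact_mod_cast hm
  set g : Ω → ℝ := C.indicator 1
  have hg : Measurable g := measurable_one.indicator hC
  have hg01 : ∀ ω, g ω ∈ Set.Icc (0 : ℝ) 1 := fun ω =>
    ⟨Set.indicator_nonneg (fun _ _ => zero_le_one) _,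
      Set.indicator_le_self' (fun _ _ => zero_le_one) ω⟩
  have hgL : MemLp g 2 P := memLp_of_bounded (Eventually.of_forall hg01)
    hg.aestronglyMeasurable 2
  have hgi : ∀ i : Fin m, MemLp (fun T : Fin m → Ω => g (T i)) 2 (Measure.pi fun _ => P) :=
    fun i => hgL.comp_measurePreserving (measurePreserving_eval (fun _ : Fin m => P) i)
  set Y : (Fin m → Ω) → ℝ := ∑ i, fun T => g (T i)
  have hY : MemLp Y 2 (Measure.pi fun _ : Fin m => P) := memLp_finsetSum' _ fun i _ => hgi i
  have hvar : ProbabilityTheory.variance Y (Measure.pi fun _ : Fin m => P) ≤ m := by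
    rw [ProbabilityTheory.variance_sum_pi (X := fun _ => g) (fun _ => hgL), Finset.sum_const,
      Finset.card_univ, Fintype.card_fin, nsmul_eq_mul]
    have := ProbabilityTheory.variance_le_sq_of_bounded (Eventually.of_forall hg01)
      hg.aemeasurable (μ := P)
    nlinarith
  have hmean : ∫ T, Y T ∂(Measure.pi fun _ : Fin m => P) = m * P.real C := by
    have h1 : ∀ i : Fin m, ∫ T : Fin m → Ω, g (T i) ∂(Measure.pi fun _ => P) = P.real C := by
      intro i
      rw [← integral_indicator_one hC]
      exact (measurePreserving_eval (fun _ : Fin m => P) i).hasLaw.integral_comp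
        hg.aestronglyMeasurable
    simp only [Y, Finset.sum_apply]
    rw [integral_finsetSum _ fun i _ => (hgi i).integrable (by norm_num)]
    simp [h1]
  have hch := ProbabilityTheory.meas_ge_le_variance_div_sq hY (mul_pos hm' hδ)
  refine (le_trans (measure_mono fun T hT => ?_) hch).trans (ENNReal.ofReal_le_ofReal ?_)
  · have hT' : δ ≤ |empFreq T C - P.real C| := hT
    show m * δ ≤ |Y T - _|
    rw [hmean]
    have : Y T - m * P.real C = m * (empFreq T C - P.real C) := by
      simp only [Y, empFreq, Finset.sum_apply]
      field_simp
      rfl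
    rw [this, abs_mul, abs_of_pos hm']
    gcongr
  · rw [div_le_div_iff₀ (by positivity) (by positivity)]
    have : 0 ≤ (m : ℝ) * δ ^ 2 := by positivity
    nlinarith

/-- Finitely many lower brackets for the sublevel sets of a function. -/
theorem exists_lower_brackets {Ω : Type*} [MeasurableSpace Ω] (P : Measure Ω)
    [IsProbabilityMeasure P] {D : Set Ω} (hD : MeasurableSet D) {f : Ω → ℝ} (hf : Measurable f)
    {N : ℕ} (hN : 0 < N) :
    ∃ C : Fin (N + 1) → Set Ω, (∀ k, MeasurableSet (C k)) ∧
      ∀ t : ℝ, ∃ k, C k ⊆ D ∩ {ω | f ω ≤ t} ∧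
        P.real (D ∩ {ω | f ω ≤ t}) ≤ P.real (C k) + 1 / N := by
  have hN' : (0 : ℝ) < N := by exact_mod_cast hN
  set A : ℝ → Set Ω := fun t => D ∩ {ω | f ω ≤ t}
  have hA : ∀ t, MeasurableSet (A t) := fun t => hD.inter (measurableSet_le hf measurable_const)
  have hmono : Monotone A := fun s t hst ω hω => ⟨hω.1, le_trans hω.2 hst⟩
  -- The bracket `C k` is the intersection of the sublevel sets of mass at least `k / N`. Rational
  -- levels keep it countable, hence measurable, and continuity from above gives it mass at least `k
  -- / N`. Mass 1 has index `N`, hence `N + 1` brackets.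
  set G : ℕ → Set ℚ := fun k => {q | (k : ℝ) / N ≤ P.real (A q)}
  refine ⟨fun k => ⋂ q : G k, A (q : ℚ), fun k => MeasurableSet.iInter fun q => hA _,
    fun t => ?_⟩
  have ht0 : 0 ≤ N * P.real (A t) := by positivity
  have hk : ⌊N * P.real (A t)⌋₊ < N + 1 := by
    rw [Nat.lt_succ_iff]
    refine Nat.floor_le_of_le ?_
    have : P.real (A t) ≤ 1 := measureReal_le_one
    nlinarith
  refine ⟨⟨_, hk⟩, ?_, ?_⟩
  · intro ω hω
    have hmem : ∀ q : ℚ, t ≤ q → ω ∈ A q := fun q hq => by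
      refine Set.mem_iInter.1 hω ⟨q, ?_⟩
      show ((_ : ℕ) : ℝ) / N ≤ P.real (A q)
      rw [div_le_iff₀ hN']
      refine (Nat.floor_le ht0).trans ?_
      rw [mul_comm]
      exact mul_le_mul_of_nonneg_right (measureReal_mono (hmono hq)) hN'.le
    obtain ⟨q, hq⟩ := exists_rat_gt t
    refine ⟨(hmem q hq.le).1, show f ω ≤ t from le_of_forall_gt_imp_ge_of_dense fun s hs => ?_⟩
    obtain ⟨q, hq1, hq2⟩ := exists_rat_btwn hs
    exact (hmem q hq1.le).2.trans hq2.le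
  · set k := ⌊N * P.real (A t)⌋₊
    have hlt : P.real (A t) < (k : ℝ) / N + 1 / N := by
      rw [← add_div, lt_div_iff₀ hN', mul_comm]
      exact Nat.lt_floor_add_one _
    refine hlt.le.trans (add_le_add_left ?_ _)
    obtain ⟨q, hq⟩ := exists_rat_gt t
    have hqG : q ∈ G k := by
      show (k : ℝ) / N ≤ P.real (A q)
      rw [div_le_iff₀ hN']
      refine (Nat.floor_le ht0).trans ?_
      rw [mul_comm]
      exact mul_le_mul_of_nonneg_right (measureReal_mono (hmono hq.le)) hN'.le
    have hdir : Directed (· ⊇ ·) fun q : G k => A (q : ℚ) := by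
      intro a b
      rcases le_total (a : ℚ) (b : ℚ) with h | h
      · exact ⟨a, le_rfl, hmono (by exact_mod_cast h)⟩
      · exact ⟨b, hmono (by exact_mod_cast h), le_rfl⟩
    rw [Measure.real, hdir.measure_iInter (fun q => (hA _).nullMeasurableSet)
      ⟨⟨q, hqG⟩, measure_ne_top P _⟩]
    have hne : ⨅ q : G k, P (A (q : ℚ)) ≠ ∞ :=
      ne_top_of_le_ne_top (measure_ne_top P (A q)) (iInf_le (fun q : G k => P (A (q : ℚ))) ⟨q, hqG⟩)
    rw [← ENNReal.ofReal_le_iff_le_toReal hne]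
    exact le_iInf fun q => (ENNReal.ofReal_le_iff_le_toReal (measure_ne_top P _)).2 q.2

section Shift

variable {X : Type*}

/-- The set where `f + b` is wrong. -/
def errorSet (f : X → ℝ) (b : ℝ) : Set (X × Label) := {z | (z.2 : ℝ) * (f z.1 + b) ≤ 0}

/-- Splitting by label turns errors into sublevel sets of `f` and of `-f`, each monotone in its
threshold, so one-dimensional brackets suffice. -/
theorem errorSet_eq (f : X → ℝ) (b : ℝ) :
    errorSet f b = ({z : X × Label | (z.2 : ℝ) = 1} ∩ {z | f z.1 ≤ -b}) ∪
      ({z : X × Label | (z.2 : ℝ) = -1} ∩ {z | -f z.1 ≤ b}) := by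
  ext z
  simp only [errorSet, Set.mem_union, Set.mem_inter_iff, Set.mem_ofPred_eq]
  rcases z.2.2 with h | h <;> rw [h] <;> norm_num
  · exact le_neg_iff_add_nonpos_right.symm
  · constructor <;> intro h <;> linarith

theorem disjoint_labels (A B : Set (X × Label)) :
    Disjoint ({z : X × Label | (z.2 : ℝ) = 1} ∩ A) ({z : X × Label | (z.2 : ℝ) = -1} ∩ B) := by
  rw [Set.disjoint_left]
  rintro z ⟨h, -⟩ ⟨h', -⟩
  simp only [Set.mem_ofPred_eq] at h h'
  rw [h] at h'
  norm_num at h'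

theorem empZeroOneRisk_add_const {m : ℕ} (T : Fin m → X × Label) (f : X → ℝ) (b : ℝ) :
    empZeroOneRisk T (fun x => f x + b) = empFreq T (errorSet f b) := by
  simp only [empZeroOneRisk, empFreq, Set.indicator_apply, errorSet, Set.mem_ofPred_eq,
    Pi.one_apply]

variable [MeasurableSpace X]

theorem measurableSet_errorSet {f : X → ℝ} (hf : Measurable f) (b : ℝ) :
    MeasurableSet (errorSet f b) :=
  measurableSet_le (by fun_prop) measurable_const

/-- Selecting the shift by empirical risk minimization is consistent, uniformly in the function
`f` that is shifted. -/
theorem exists_tendsto_measure_zeroOneRisk_erm (P : Measure (X × Label)) [IsProbabilityMeasure P]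
    {τ : ℝ} (hτ : 0 < τ) :
    ∃ κ : ℕ → ℝ≥0∞, Tendsto κ atTop (𝓝 0) ∧
      ∀ (f : X → ℝ), Measurable f → ∀ (m : ℕ), 0 < m → ∀ bT : (Fin m → X × Label) → ℝ,
        (∀ T b, empZeroOneRisk T (fun x => f x + bT T) ≤ empZeroOneRisk T (fun x => f x + b)) →
        ∀ b₀ : ℝ, (Measure.pi fun _ : Fin m => P)
          {T | zeroOneRisk P (fun x => f x + b₀) + τ ≤ zeroOneRisk P (fun x => f x + bT T)} ≤
            κ m := by
  -- Five errors of at most `τ / 8` occur: two bracket widths, two bracket deviations, and the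
  -- deviation at `b₀`.
  obtain ⟨n, hn⟩ := exists_nat_one_div_lt (show 0 < τ / 8 by linarith)
  set N := n + 1
  have hN : (1 : ℝ) / (N : ℕ) < τ / 8 := by simpa [N] using hn
  -- The index `none` stands for the error set of the comparison shift `b₀`. Lower brackets suffice,
  -- since the empirical risk of the selected shift is only bounded from below.
  set ι := Option (Fin (N + 1) ⊕ Fin (N + 1))
  refine ⟨fun m => Fintype.card ι * ENNReal.ofReal (1 / (m * (τ / 8) ^ 2)), ?_, ?_⟩
  · have h1 : Tendsto (fun m : ℕ => 1 / ((m : ℝ) * (τ / 8) ^ 2)) atTop (𝓝 0) :=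
      tendsto_const_nhds.div_atTop
        (tendsto_natCast_atTop_atTop.atTop_mul_const (by positivity))
    have h2 := ENNReal.Tendsto.const_mul (ENNReal.tendsto_ofReal h1)
      (Or.inr (ENNReal.natCast_ne_top (Fintype.card ι)))
    simpa using h2
  intro f hf m hm bT hbT b₀
  have hy : Measurable fun z : X × Label => (z.2 : ℝ) := by fun_prop
  have hfx : Measurable fun z : X × Label => f z.1 := by fun_prop
  obtain ⟨C, hC, hCb⟩ := exists_lower_brackets P (measurableSet_eq_fun hy measurable_const) hfx
    (D := {z : X × Label | (z.2 : ℝ) = 1}) (Nat.succ_pos n)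
  obtain ⟨C', hC', hCb'⟩ := exists_lower_brackets P (measurableSet_eq_fun hy measurable_const)
    (f := fun z => -f z.1) hfx.neg (D := {z : X × Label | (z.2 : ℝ) = -1}) (Nat.succ_pos n)
  set B : ι → Set (X × Label) := fun i => i.elim (errorSet f b₀) (Sum.elim C C')
  have hB : ∀ i, MeasurableSet (B i) := by
    rintro (_ | i | i)
    exacts [measurableSet_errorSet hf b₀, hC i, hC' i]
  calc _ ≤ (Measure.pi fun _ : Fin m => P)
        (⋃ i : ι, {T | τ / 8 ≤ |empFreq T (B i) - P.real (B i)|}) := by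
        refine measure_mono fun T hT => ?_
        by_contra hcon
        simp only [Set.mem_iUnion, Set.mem_ofPred_eq, not_exists, not_le] at hcon
        obtain ⟨k, hk1, hk2⟩ := hCb (-bT T)
        obtain ⟨l, hl1, hl2⟩ := hCb' (bT T)
        have e0 := abs_lt.1 (hcon none)
        have e1 := abs_lt.1 (hcon (some (Sum.inl k)))
        have e2 := abs_lt.1 (hcon (some (Sum.inr l)))
        simp only [B, Option.elim, Sum.elim_inl, Sum.elim_inr] at e0 e1 e2
        have hmin := hbT T b₀
        rw [empZeroOneRisk_add_const, empZeroOneRisk_add_const, errorSet_eq f (bT T),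
          empFreq_union _ (disjoint_labels _ _)] at hmin
        have hP := measureReal_union (μ := P)
          (disjoint_labels {z : X × Label | f z.1 ≤ -bT T} {z | -f z.1 ≤ bT T})
          ((measurableSet_eq_fun hy measurable_const).inter
            (measurableSet_le hfx.neg measurable_const))
        rw [← errorSet_eq] at hP
        have hT' : P.real (errorSet f b₀) + τ ≤ P.real (errorSet f (bT T)) := hT
        have i1 := empFreq_mono T hk1
        have i2 := empFreq_mono T hl1
        linarith
    _ ≤ ∑ i : ι, (Measure.pi fun _ : Fin m => P)
        {T | τ / 8 ≤ |empFreq T (B i) - P.real (B i)|} := measure_iUnion_fintype_le _ _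
    _ ≤ ∑ i : ι, ENNReal.ofReal (1 / (m * (τ / 8) ^ 2)) :=
        Finset.sum_le_sum fun i _ => measure_le_abs_empFreq_sub P hm (hB i) (by linarith)
    _ = _ := by rw [Finset.sum_const, Finset.card_univ, nsmul_eq_mul]

end Shift

/-! ### Consistency of the two-stage estimator -/

/-- The functions in the reproducing kernel Hilbert space of a continuous kernel are continuous. -/
theorem HasKernel.continuous_coe {X : Type*} [TopologicalSpace X] {H : Type*}
    [NormedAddCommGroup H] [InnerProductSpace ℝ H] [CompleteSpace H] [RKHS ℝ H X ℝ]
    {k : X → X → ℝ} (hH : HasKernel H k) (hk : Continuous fun p : X × X => k p.1 p.2) (f : H) :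
    Continuous fun x => f x := by
  have hker : Continuous fun x => RKHS.kerFun H x (1 : ℝ) := by
    rw [continuous_iff_continuousAt]
    intro x
    have hnorm : ∀ y, ‖RKHS.kerFun H y (1 : ℝ) - RKHS.kerFun H x (1 : ℝ)‖ =
        √(k y y - 2 * k y x + k x x) := by
      intro y
      have hin : ∀ u v, inner ℝ (RKHS.kerFun H u (1 : ℝ)) (RKHS.kerFun H v (1 : ℝ)) = k u v := by
        intro u v
        rw [RKHS.kerFun_inner, RKHS.kerFun_apply, hH u v]
        simp
      rw [← hin y y, ← hin y x, ← hin x x, real_inner_self_eq_norm_sq, real_inner_self_eq_norm_sq,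
        ← norm_sub_sq_real, Real.sqrt_sq (norm_nonneg _)]
    have hk1 : Continuous fun y => k y y := hk.comp (continuous_id.prodMk continuous_id)
    have hk2 : Continuous fun y => k y x := hk.comp (continuous_id.prodMk continuous_const)
    have hlim : Tendsto (fun y => √(k y y - 2 * k y x + k x x)) (𝓝 x)
        (𝓝 √(k x x - 2 * k x x + k x x)) :=
      (((hk1.sub (hk2.const_mul 2)).add continuous_const).sqrt).tendsto x
    rw [show k x x - 2 * k x x + k x x = 0 by ring, Real.sqrt_zero] at hlim
    exact tendsto_iff_norm_sub_tendsto_zero.2 (by simpa only [hnorm] using hlim)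
  have heq : (fun x => f x) = fun x => inner ℝ (RKHS.kerFun H x (1 : ℝ)) f := by
    ext x
    rw [RKHS.kerFun_inner]
    simp
  rw [heq]
  exact hker.inner continuous_const

/-- A measurable set in a product has small measure, if its slices have small measure outside of a
set of small measure. -/
theorem measure_prod_le_add {α β : Type*} [MeasurableSpace α] [MeasurableSpace β] (μ : Measure α)
    [IsProbabilityMeasure μ] (ν : Measure β) [IsProbabilityMeasure ν] {B : Set (α × β)}
    (hB : MeasurableSet B) (N : Set α) (κ : ℝ≥0∞) (h : ∀ a ∉ N, ν (Prod.mk a ⁻¹' B) ≤ κ) :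
    μ.prod ν B ≤ μ N + κ := by
  rw [Measure.prod_apply hB]
  calc ∫⁻ a, ν (Prod.mk a ⁻¹' B) ∂μ
      -- `N` need not be measurable, so a measurable hull of equal measure replaces it.
      ≤ ∫⁻ a, ((toMeasurable μ N).indicator 1 a + κ) ∂μ := by
        refine lintegral_mono fun a => ?_
        by_cases ha : a ∈ toMeasurable μ N
        · rw [Set.indicator_of_mem ha]
          exact le_add_right prob_le_one
        · rw [Set.indicator_of_notMem ha, zero_add]
          exact h a fun ha' => ha (subset_toMeasurable μ N ha')
    _ = μ N + κ := by
        rw [lintegral_add_right _ measurable_const,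
          lintegral_indicator_one (measurableSet_toMeasurable μ N), measure_toMeasurable,
          lintegral_const, measure_univ, mul_one]

/-- The 0-1 risk of a function and a shift depending measurably on a parameter is measurable. -/
theorem measurable_zeroOneRisk_add {X α : Type*} [TopologicalSpace X]
    [TopologicalSpace.MetrizableSpace X] [SecondCountableTopology X] [MeasurableSpace X] [OpensMeasurableSpace X] [MeasurableSpace α]
    (P : Measure (X × Label)) [IsProbabilityMeasure P] {F : α → X → ℝ} {b : α → ℝ}
    (hc : ∀ a, Continuous (F a)) (hF : ∀ x, Measurable fun a => F a x) (hb : Measurable b) :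
    Measurable fun a => zeroOneRisk P fun x => F a x + b a := by
  have hjoint : Measurable fun p : X × α => F p.2 p.1 :=
    measurable_uncurry_of_continuous_of_measurable (u := fun x a => F a x) hc hF
  have hm : Measurable fun q : α × (X × Label) => (q.2.2 : ℝ) * (F q.1 q.2.1 + b q.1) :=
    (measurable_subtype_coe.comp (measurable_snd.comp measurable_snd)).mul
      ((hjoint.comp ((measurable_fst.comp measurable_snd).prodMk measurable_fst)).add
        (hb.comp measurable_fst))
  exact (measurable_measure_prodMk_left (ν := P)
    (measurableSet_le hm measurable_const)).ennreal_toReal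

/-- Consistency of the two-stage estimator. Calibration holds uniformly in the margin parameter
(below `-ℓ(0)/2` the surrogate risk exceeds that of the zero function), so that only the convergence
of the surrogate risk is needed of the first stage, not that it solves the empirical problem. -/
theorem mainTheorem4
    {X : Type*} [MetricSpace X] [CompactSpace X] [MeasurableSpace X] [BorelSpace X]
    (P : Measure (X × Label)) [IsProbabilityMeasure P]
    {H : Type*} [NormedAddCommGroup H] [InnerProductSpace ℝ H] [CompleteSpace H] [RKHS ℝ H X ℝ]
    (k : X → X → ℝ) (hH : HasKernel H k) (hk : UniversalKernel H k)
    (ℓ : ℝ → ℝ) (hℓ : BasicLoss ℓ) (hcal : ModifiedClassificationCalibrated ℓ)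
    (lam : ℕ → ℝ) (hlam : ∀ m, 0 < lam m)
    -- the estimators computed from the first sample
    (fHat : ∀ m : ℕ, (Fin m → X × Label) → H)
    (bHat ρHat : ∀ m : ℕ, (Fin m → X × Label) → ℝ)
    (hf_meas : ∀ m x, Measurable fun T : Fin m → X × Label => fHat m T x)
    (hb_meas : ∀ m, Measurable (bHat m))
    (hρ_meas : ∀ m, Measurable (ρHat m))
    -- they solve the regularized empirical problem whenever it has a solution
    (hmin : ∀ (m : ℕ) (T : Fin m → X × Label),
      (∃ (f : H) (b ρ : ℝ), IsRegularizedMinimizer ℓ (lam m) T f b ρ) →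
        IsRegularizedMinimizer ℓ (lam m) T (fHat m T) (bHat m T) (ρHat m T))
    -- the bias minimizes the empirical 0-1 loss on the second sample
    (bTilde : ∀ m₁ m₂ : ℕ, (Fin m₁ → X × Label) → (Fin m₂ → X × Label) → ℝ)
    (hbt_meas : ∀ m₁ m₂, Measurable
      fun T : (Fin m₁ → X × Label) × (Fin m₂ → X × Label) => bTilde m₁ m₂ T.1 T.2)
    (hbt_min : ∀ (m₁ m₂ : ℕ) (T₁ : Fin m₁ → X × Label) (T₂ : Fin m₂ → X × Label) (b : ℝ),
      empZeroOneRisk T₂ (fun x => fHat m₁ T₁ x + bTilde m₁ m₂ T₁ T₂) ≤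
        empZeroOneRisk T₂ (fun x => fHat m₁ T₁ x + b))
    -- the surrogate risk converges in probability to its infimum
    (hconv : TendstoInProbability (fun m : ℕ => Measure.pi fun _ : Fin m => P)
      (fun m T => surrogateRisk ℓ P (fun x => fHat m T x + bHat m T) (ρHat m T))
      atTop (optSurrogateRisk ℓ P)) :
    TendstoInProbability
      (fun m : ℕ × ℕ =>
        (Measure.pi fun _ : Fin m.1 => P).prod (Measure.pi fun _ : Fin m.2 => P))
      (fun m T => zeroOneRisk P fun x => fHat m.1 T.1 x + bTilde m.1 m.2 T.1 T.2)
      (atTop ×ˢ atTop) (bayesRisk P) := by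
  have hcont : ∀ f : H, Continuous fun x => f x := hH.continuous_coe hk.continuous_kernel
  have hfm : ∀ f : H, Measurable fun x => f x := fun f => (hcont f).measurable
  have hmeas : ∀ m₁ m₂ : ℕ, Measurable fun T : (Fin m₁ → X × Label) × (Fin m₂ → X × Label) =>
      zeroOneRisk P fun x => fHat m₁ T.1 x + bTilde m₁ m₂ T.1 T.2 := fun m₁ m₂ =>
    measurable_zeroOneRisk_add P (fun T => hcont (fHat m₁ T.1))
      (fun x => (hf_meas m₁ x).comp measurable_fst) (hbt_meas m₁ m₂)
  intro U hU
  obtain ⟨τ, hτ, hτU⟩ := Metric.mem_nhds_iff.1 hU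
  obtain ⟨V, hV, hVb⟩ := eventually_exists_zeroOneRisk_add_const_lt P hℓ hcal (half_pos hτ)
  obtain ⟨κ, hκ, hκb⟩ := exists_tendsto_measure_zeroOneRisk_erm P (half_pos hτ)
  have hlim : Tendsto (fun m : ℕ × ℕ => (Measure.pi fun _ : Fin m.1 => P)
      {T | surrogateRisk ℓ P (fun x => fHat m.1 T x + bHat m.1 T) (ρHat m.1 T) ∉ V} + κ m.2)
      (atTop ×ˢ atTop) (𝓝 0) := by
    simpa using ((hconv V hV).comp tendsto_fst).add (hκ.comp tendsto_snd)
  have hbad : ∀ m₁ m₂ : ℕ, 0 < m₂ →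
      (Measure.pi fun _ : Fin m₁ => P).prod (Measure.pi fun _ : Fin m₂ => P)
        {T | bayesRisk P + τ ≤ zeroOneRisk P fun x => fHat m₁ T.1 x + bTilde m₁ m₂ T.1 T.2} ≤
      (Measure.pi fun _ : Fin m₁ => P)
        {T | surrogateRisk ℓ P (fun x => fHat m₁ T x + bHat m₁ T) (ρHat m₁ T) ∉ V} + κ m₂ := by
    intro m₁ m₂ hm
    refine measure_prod_le_add _ _ (measurableSet_le measurable_const (hmeas m₁ m₂)) _ _
      fun T₁ hT₁ => ?_
    obtain ⟨b, hb⟩ := hVb _ _ ((hfm (fHat m₁ T₁)).add_const (bHat m₁ T₁)) (not_not.1 hT₁)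
    refine (measure_mono fun T₂ hT₂ => ?_).trans (hκb _ (hfm (fHat m₁ T₁)) m₂ hm
      (fun T₂ => bTilde m₁ m₂ T₁ T₂) (fun T₂ b => hbt_min m₁ m₂ T₁ T₂ b) (bHat m₁ T₁ + b))
    have h2 : bayesRisk P + τ ≤
      zeroOneRisk P fun x => fHat m₁ T₁ x + bTilde m₁ m₂ T₁ T₂ := hT₂
    simp only [add_assoc] at hb
    show _ + τ / 2 ≤ _
    linarith
  refine tendsto_of_tendsto_of_tendsto_of_le_of_le' tendsto_const_nhds hlim
    (Eventually.of_forall fun _ => zero_le) ?_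
  -- On an empty second sample every shift has empirical risk 0, so minimality carries no
  -- information.
  filter_upwards [(eventually_gt_atTop (0 : ℕ)).prod_inr atTop] with m hm
  refine (measure_mono fun T hT => ?_).trans (hbad m.1 m.2 hm)
  by_contra hlt
  have hlt' : zeroOneRisk P (fun x => fHat m.1 T.1 x + bTilde m.1 m.2 T.1 T.2) <
    bayesRisk P + τ := not_le.1 hlt
  refine hT (hτU ?_)
  -- The 0-1 risk never falls below the Bayes risk, so only upward deviations matter.
  have := bayesRisk_le_zeroOneRisk P
    ((hfm (fHat m.1 T.1)).add_const (bTilde m.1 m.2 T.1 T.2))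
  rw [Metric.mem_ball, Real.dist_eq, abs_of_nonneg (by linarith)]
  linarith
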